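/- Let $\Bbbk$ be a field, $S=\Bbbk[x_1,\dots,x_n]$ ($n\ge 0$), $\mathfrak m=(x_1,\dots,x_n)$, and let $J\subseteq I$ be monomial ideals of $S$ (the zero ideal and $S$ are allowed). Put $d=\dim(I/J)$, the Krull dimension of the $S$-module $I/J$, with $\dim 0=-1$. The module $I/J$ is called Cohen–Macaulay if $I/J=0$ or its depth with respect to $\mathfrak m$ (the supremum of the lengths of $I/J$-regular sequences of elements of $\mathfrak m$) equals $d$. A simplicial complex on $[n]=\{1,\dots,n\}$ is a set of subsets of $[n]$ closed under taking subsets; both $\varnothing$ and $\{\varnothing\}$ are allowed. For a complex $\Delta$ and $F\subseteq[n]$, $\operatorname{link}_\Delta F=\{G\subseteq[n] : G\cap F=\varnothing,\ G\cup F\in\Delta\}$ (which is empty if $F\notin\Delta$). For $\mathbf a\in\mathbb Z^n$ put $G_{\mathbf a}=\{i : a_i<0\}$. For a monomial ideal $K$, the degree complex $\Delta_{\mathbf a}(K)$ consists of all $F\subseteq[n]$ with $F\cap G_{\mathbf a}=\varnothing$ such that for every minimal monomial generator $x^{\mathbf b}$ of $K$ there is an index $i\notin F\cup G_{\mathbf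 a}$ with $b_i>a_i$. For complexes $\Gamma\subseteq\Delta$, let $\mathcal C(\Delta)_\bullet$ be the augmented oriented chain complex over $\mathbb Z$ (with $\varnothing$ in degree $-1$ if $\varnothing\in\Delta$), and let $\widetilde H^j((\Delta,\Gamma);\Bbbk)=H^j\big(\operatorname{Hom}_{\mathbb Z}(\mathcal C(\Delta)_\bullet/\mathcal C(\Gamma)_\bullet,\Bbbk)\big)$ for $j\in\mathbb Z$. **Relative Reisner criterion.** The following are equivalent: 1. $I/J$ is Cohen–Macaulay. 2. For every $\mathbf a\in\mathbb Z^n$ and every face $F\in\Delta_{\mathbf a}(J)$, $$\widetilde H^j\big((\operatorname{link}_{\Delta_{\mathbf a}(J)}F,\ \operatorname{link}_{\Delta_{\mathbf a}(I)}F);\Bbbk\big)=0\quad\text{for all integers } j<d-|G_{\mathbf a}|-|F|-1 .$$ -/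

import Mathlib

open MvPolynomial

namespace RelReisner

/-! ### Dimension, depth and the Cohen–Macaulay property -/

/-- Krull dimension of a module as an integer, with `dim 0 = -1`. -/
noncomputable def moduleDim (R M : Type*) [CommRing R] [AddCommGroup M] [Module R M] : ℤ :=
  WithBot.recBotCoe (-1) (fun m : ℕ∞ => (m.toNat : ℤ)) (Module.supportDim R M)

/-- The depth of `M` with respect to an ideal `𝔞`: the supremum of the lengths of the
`M`-regular sequences with all members in `𝔞`. -/
noncomputable def depth {R : Type*} [CommRing R] (𝔞 : Ideal R)
    (M : Type*) [AddCommGroup M] [Module R M] : ℕ∞ :=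
  ⨆ rs : {rs : List R // (∀ r ∈ rs, r ∈ 𝔞) ∧ RingTheory.Sequence.IsRegular M rs},
    (rs.1.length : ℕ∞)

/-- A (graded) module over `k[x_1, …, x_n]` is Cohen–Macaulay if it is zero or if its depth with
respect to the graded maximal ideal `(x_1, …, x_n)` equals its Krull dimension. -/
def IsCohenMacaulay (k : Type*) [Field k] (n : ℕ)
    (M : Type*) [AddCommGroup M] [Module (MvPolynomial (Fin n) k) M] : Prop :=
  Subsingleton M ∨
    Module.supportDim (MvPolynomial (Fin n) k) M =
      ((depth (idealOfVars (Fin n) k) M : ℕ∞) :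
        WithBot ℕ∞)

/-! ### Monomial ideals -/

/-- An ideal generated by a set of monomials. -/
def IsMonomialIdeal {k : Type*} [Field k] {n : ℕ} (I : Ideal (MvPolynomial (Fin n) k)) : Prop :=
  ∃ A : Set (Fin n →₀ ℕ), I = Ideal.span ((fun b => monomial b (1 : k)) '' A)

/-- The exponents of the minimal monomial generators of a monomial ideal: the exponents of those
monomials of `I` that are minimal with respect to divisibility. -/
def minGenExponents {k : Type*} [Field k] {n : ℕ} (I : Ideal (MvPolynomial (Fin n) k)) :
    Set (Fin n →₀ ℕ) :=
  {b | Minimal (fun c : Fin n →₀ ℕ => monomial c (1 : k) ∈ I) b}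

/-! ### Simplicial complexes -/

/-- A simplicial complex on `{1, …, n}`: a set of subsets closed under passing to subsets. Both
the empty complex and `{∅}` are allowed, and the singletons need not be faces. -/
abbrev Complex (n : ℕ) := LowerSet (Finset (Fin n))

/-- The link of `F` in `Δ`. -/
def link {n : ℕ} (Δ : Complex n) (F : Finset (Fin n)) : Complex n where
  carrier := {G | Disjoint G F ∧ G ∪ F ∈ Δ}
  lower' := fun _ _ hHG hG =>
    ⟨hG.1.mono_left hHG, Δ.lower (Finset.union_subset_union_left hHG) hG.2⟩

/-- The set `G_a` of the indices of the negative entries of `a`. -/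
def negSupport {n : ℕ} (a : Fin n → ℤ) : Finset (Fin n) := Finset.univ.filter fun i => a i < 0

/-- The degree complex `Δ_a(I)`. -/
def degreeComplex {k : Type*} [Field k] {n : ℕ} (I : Ideal (MvPolynomial (Fin n) k))
    (a : Fin n → ℤ) : Complex n where
  carrier := {F | Disjoint F (negSupport a) ∧
    ∀ b ∈ minGenExponents I, ∃ i, i ∉ F ∪ negSupport a ∧ a i < (b i : ℤ)}
  lower' := fun _ _ hEF hF => ⟨hF.1.mono_left hEF, fun b hb => by
    obtain ⟨i, hi, hab⟩ := hF.2 b hb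
    exact ⟨i, fun h => hi (Finset.union_subset_union_left hEF h), hab⟩⟩

/-! ### Reduced relative cohomology -/

/-- The augmented oriented chains of dimension `j` of `Δ`: the free abelian group on the faces
with `j + 1` elements (so it is spanned by `∅` for `j = -1` if `∅ ∈ Δ`). -/
noncomputable def chains {n : ℕ} (Δ : Complex n) (j : ℤ) : Submodule ℤ (Finset (Fin n) →₀ ℤ) :=
  Finsupp.supported ℤ ℤ {F | F ∈ Δ ∧ (F.card : ℤ) = j + 1}

/-- The boundary `∂{i_0 < ⋯ < i_t} = ∑_j (-1)^j {i_0, …, î_j, …, i_t}`; the position of `v` in `F`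
is the number of the members of `F` below `v`. -/
noncomputable def boundary (n : ℕ) : (Finset (Fin n) →₀ ℤ) →ₗ[ℤ] (Finset (Fin n) →₀ ℤ) :=
  Finsupp.linearCombination ℤ fun F =>
    ∑ v ∈ F, Finsupp.single (F.erase v) ((-1 : ℤ) ^ (F.filter (· < v)).card)

theorem boundary_mem_chains {n : ℕ} (Δ : Complex n) {i j : ℤ} (h : i + 1 = j)
    {c : Finset (Fin n) →₀ ℤ} (hc : c ∈ chains Δ j) : boundary n c ∈ chains Δ i := by
  rw [boundary, Finsupp.linearCombination_apply]
  refine Submodule.sum_mem _ fun F hF => Submodule.smul_mem _ _ (Submodule.sum_mem _ fun v hv => ?_)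
  obtain ⟨hFΔ, hcard⟩ := (Finsupp.mem_supported _ _).1 hc hF
  refine Finsupp.single_mem_supported ℤ _ ⟨Δ.lower (Finset.erase_subset v F) hFΔ, ?_⟩
  have := Finset.card_erase_add_one hv
  omega

theorem boundary_boundary {n : ℕ} (c : Finset (Fin n) →₀ ℤ) : boundary n (boundary n c) = 0 := by
  induction c using Finsupp.induction_linear with
  | zero => simp
  | add f g hf hg => simp [hf, hg]
  | single F a =>
    simp only [boundary, Finsupp.linearCombination_single, map_smul, map_sum, Finset.smul_sum]
    have key : ∀ v w : Fin n, v ∈ F → v < w →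
        (-1 : ℤ) ^ (F.filter (· < v)).card * (-1) ^ ((F.erase v).filter (· < w)).card +
          (-1) ^ (F.filter (· < w)).card * (-1) ^ ((F.erase w).filter (· < v)).card = 0 := by
      intro v w hv hlt
      have h1 : (F.erase w).filter (· < v) = F.filter (· < v) := by
        rw [Finset.filter_erase, Finset.erase_eq_of_notMem]
        simp [hlt.le]
      have h2 : ((F.erase v).filter (· < w)).card + 1 = (F.filter (· < w)).card := by
        rw [Finset.filter_erase]
        exact Finset.card_erase_add_one (by simp [hv, hlt])
      rw [h1, ← h2, pow_succ]
      ring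
    rw [Finset.sum_sigma']
    refine Finset.sum_involution (fun p _ => ⟨p.2, p.1⟩) ?_ ?_ ?_ ?_
    · rintro ⟨v, w⟩ h
      simp only [Finset.mem_sigma, Finset.mem_erase] at h
      obtain ⟨hv, hwv, hw⟩ := h
      dsimp only
      rw [Finset.erase_right_comm (a := w) (b := v), ← smul_add, Finsupp.smul_single,
        Finsupp.smul_single, ← Finsupp.single_add, smul_eq_mul, smul_eq_mul]
      rcases lt_or_gt_of_ne hwv with hlt | hlt
      · rw [add_comm, key w v hw hlt]
        simp
      · rw [key v w hv hlt]
        simp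
    · rintro ⟨v, w⟩ h _ h'
      simp only [Finset.mem_sigma, Finset.mem_erase] at h
      exact h.2.1 (congrArg Sigma.fst h')
    · rintro ⟨v, w⟩ h
      simp only [Finset.mem_sigma, Finset.mem_erase] at h ⊢
      exact ⟨h.2.2, h.2.1.symm, h.1⟩
    · rintro ⟨v, w⟩ h
      rfl

/-- The boundary `C_j(Δ) → C_i(Δ)`, `j = i + 1`. -/
noncomputable def chainsBoundary {n : ℕ} (Δ : Complex n) {i j : ℤ} (h : i + 1 = j) :
    chains Δ j →ₗ[ℤ] chains Δ i :=
  (boundary n).restrict fun _ hc => boundary_mem_chains Δ h hc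

/-- The relative chains `C_j(Δ) / C_j(Γ)`. -/
abbrev relChains {n : ℕ} (Δ Γ : Complex n) (j : ℤ) :=
  chains Δ j ⧸ (chains Γ j).submoduleOf (chains Δ j)

/-- The boundary of the quotient complex `C(Δ) / C(Γ)`. -/
noncomputable def relBoundary {n : ℕ} (Δ Γ : Complex n) {i j : ℤ} (h : i + 1 = j) :
    relChains Δ Γ j →ₗ[ℤ] relChains Δ Γ i :=
  Submodule.mapQ _ _ (chainsBoundary Δ h) fun _ hc => boundary_mem_chains Γ h hc

/-- The coboundary `Hom_ℤ(C_i(Δ)/C_i(Γ), k) → Hom_ℤ(C_j(Δ)/C_j(Γ), k)`, `j = i + 1`. -/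
noncomputable def relCoboundary (k : Type*) [Field k] {n : ℕ} (Δ Γ : Complex n) {i j : ℤ}
    (h : i + 1 = j) : (relChains Δ Γ i →ₗ[ℤ] k) →ₗ[k] (relChains Δ Γ j →ₗ[ℤ] k) :=
  LinearMap.lcomp k k (relBoundary Δ Γ h)

theorem relCoboundary_relCoboundary (k : Type*) [Field k] {n : ℕ} (Δ Γ : Complex n) {i j l : ℤ}
    (h : i + 1 = j) (h' : j + 1 = l) (f : relChains Δ Γ i →ₗ[ℤ] k) :
    relCoboundary k Δ Γ h' (relCoboundary k Δ Γ h f) = 0 := by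
  refine LinearMap.ext fun c => ?_
  obtain ⟨c, rfl⟩ := Submodule.Quotient.mk_surjective _ c
  have hc : chainsBoundary Δ h (chainsBoundary Δ h' c) = 0 :=
    Subtype.ext (boundary_boundary (c : Finset (Fin n) →₀ ℤ))
  change f (Submodule.Quotient.mk (chainsBoundary Δ h (chainsBoundary Δ h' c))) = 0
  rw [hc]
  exact map_zero f

/-- The reduced relative cohomology of `(Δ, Γ)` in degree `j`: cocycles modulo coboundaries of the
complex `Hom_ℤ(C(Δ)/C(Γ), k)`. -/
abbrev ReducedRelCohomology (k : Type*) [Field k] {n : ℕ} (Δ Γ : Complex n) (j : ℤ) :=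
  LinearMap.ker (relCoboundary k Δ Γ (rfl : j + 1 = j + 1)) ⧸
    (LinearMap.range (relCoboundary k Δ Γ (sub_add_cancel j 1))).submoduleOf
      (LinearMap.ker (relCoboundary k Δ Γ (rfl : j + 1 = j + 1)))

end RelReisner

open RelReisner

/-!
The proof compares both conditions with the local cohomology of `M = I/J` at `(x_1, …, x_n)`.

Local cohomology enters as the colimit over `l` of the cohomology of the Koszul complexes
`K(x_1^l, …, x_n^l; M)`. It detects depth, by the usual induction along `0 → M → M → M/rM → 0`.
If there is a regular sequence of length `t` in `(x_1, …, x_n)`, then the Koszul cohomology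
vanishes below `t` for every `l`, because a power of each `r` kills it, while `r` acts injectively
on it (`exists_koszulD_eq_of_isWeaklyRegular`). If the colimit vanishes below `t`, then no
associated prime of `M` contains `(x_1, …, x_n)`, so prime avoidance gives a nonzerodivisor `r`, and
the colimit for `M/rM` vanishes below `t - 1`
(`exists_isWeaklyRegular_of_limitKoszulVanishes`). Since depth never exceeds dimension
(`length_le_supportDim_of_isRegular`) and `(x_1, …, x_n) M ≠ M` for `M ≠ 0`, the module `M` is
Cohen–Macaulay if and only if the local cohomology vanishes below `d = dim M`.

The Koszul complex of `x_1^l, …, x_n^l` on `M` is graded by `ℤ^n`, and its component in degree `a` is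
the complex of functions on those `F ⊆ {1, …, n}` for which `x^(a + l·1_F)` is a monomial of `I`
outside `J`. For `l ≫ 0` these are the `F ⊇ G_a` such that `F \ G_a` is a face of `Δ_a(J)` but not of
`Δ_a(I)` (`eventually_isDegree_shift_iff`). Up to the shift by `|G_a|` and a sign
(`familyVanishes_union_iff`) the component is thus the relative cochain complex of
`(Δ_a(J), Δ_a(I))`, which is Takayama's formula for pairs of monomial ideals.

Finally, the links add nothing new: for `F ∈ Δ_a(J)` the links of `F` in `Δ_a(J)` and `Δ_a(I)` are
the degree complexes at the exponent obtained from `a` by putting `-1` at the places in `F`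
(`link_degreeComplex`), and this exponent has `|G_a| + |F|` negative entries.
-/

open scoped Pointwise

namespace RelReisner

/-! ### Signs -/

/-- The sign `(-1)^#{u ∈ F | u < v}`, written as a product over `F` so that it is multiplicative
in `F`. -/
def sgn {n : ℕ} (v : Fin n) (F : Finset (Fin n)) : ℤ := ∏ u ∈ F, if u < v then -1 else 1

theorem sgn_eq_pow {n : ℕ} (v : Fin n) (F : Finset (Fin n)) :
    sgn v F = (-1) ^ (F.filter (· < v)).card := by
  simp [sgn, Finset.prod_ite]

theorem sgn_mul_self {n : ℕ} (v : Fin n) (F : Finset (Fin n)) : sgn v F * sgn v F = 1 := by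
  rw [sgn, ← Finset.prod_mul_distrib]
  exact Finset.prod_eq_one fun u _ => by split_ifs <;> rfl

theorem sgn_erase_self {n : ℕ} (v : Fin n) (F : Finset (Fin n)) : sgn v (F.erase v) = sgn v F :=
  Finset.prod_erase _ (by simp)

theorem sgn_insert_self {n : ℕ} (v : Fin n) (F : Finset (Fin n)) : sgn v (insert v F) = sgn v F :=
  Finset.prod_insert_one (by simp)

theorem sgn_mul_sgn_erase {n : ℕ} {v w : Fin n} {F : Finset (Fin n)} (hv : v ∈ F) (hw : w ∈ F)
    (h : v ≠ w) : sgn v F * sgn w (F.erase v) = -(sgn w F * sgn v (F.erase w)) := by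
  have h1 := Finset.mul_prod_erase F (fun u => if u < v then (-1 : ℤ) else 1) hw
  have h2 := Finset.mul_prod_erase F (fun u => if u < w then (-1 : ℤ) else 1) hv
  change _ * sgn v (F.erase w) = sgn v F at h1
  change _ * sgn w (F.erase v) = sgn w F at h2
  rw [← h1, ← h2]
  rcases lt_or_gt_of_ne h with h | h <;> simp [h, h.not_gt] <;> ring

/-! ### Koszul cochains -/

section Koszul

variable {R : Type*} [CommRing R] {n : ℕ}

/-- The differential of the Koszul complex `K^•(x_1, …, x_n; N)`. A cochain is a function from the
subsets of `{1, …, n}` to `N`; the summand of degree `q` consists of the functions supported on the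
subsets with `q` elements. For `x = 1` this is the coboundary of the full simplex. -/
def koszulD {N : Type*} [AddCommGroup N] [Module R N] (x : Fin n → R) :
    (Finset (Fin n) → N) →ₗ[R] (Finset (Fin n) → N) where
  toFun c F := ∑ v ∈ F, sgn v F • x v • c (F.erase v)
  map_add' c e := by ext F; simp [Finset.sum_add_distrib]
  map_smul' r c := by
    ext F
    simp only [Pi.smul_apply, RingHom.id_apply, Finset.smul_sum]
    exact Finset.sum_congr rfl fun v _ => by rw [smul_comm (x v), smul_comm _ r]

/-- The cochain `c` is homogeneous of degree `q`. -/
def InDegree {N : Type*} [Zero N] (q : ℤ) (c : Finset (Fin n) → N) : Prop :=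
  ∀ F, c F ≠ 0 → (F.card : ℤ) = q

variable {N : Type*} [AddCommGroup N] [Module R N]

theorem koszulD_apply (x : Fin n → R) (c : Finset (Fin n) → N) (F : Finset (Fin n)) :
    koszulD x c F = ∑ v ∈ F, sgn v F • x v • c (F.erase v) := rfl

theorem koszulD_comp {N' : Type*} [AddCommGroup N'] [Module R N'] (f : N →ₗ[R] N')
    (x : Fin n → R) (c : Finset (Fin n) → N) :
    koszulD x (fun F => f (c F)) = fun F => f (koszulD x c F) := by
  ext F
  simp [koszulD_apply]

theorem koszulD_koszulD (x : Fin n → R) (c : Finset (Fin n) → N) :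
    koszulD x (koszulD x c) = 0 := by
  ext F
  simp only [koszulD_apply, Finset.smul_sum, Pi.zero_apply]
  rw [Finset.sum_sigma']
  refine Finset.sum_involution (fun p _ => ⟨p.2, p.1⟩) ?_ ?_ ?_ ?_
  · rintro ⟨v, w⟩ h
    simp only [Finset.mem_sigma, Finset.mem_erase] at h
    obtain ⟨hv, hwv, hw⟩ := h
    dsimp only
    rw [Finset.erase_right_comm (a := w) (b := v), smul_comm (x v) (sgn w (F.erase v)),
      smul_comm (x w) (sgn v (F.erase w)), smul_comm (x w) (x v), smul_smul, smul_smul (sgn w F),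
      sgn_mul_sgn_erase hv hw hwv.symm, neg_smul, neg_add_cancel]
  · rintro ⟨v, w⟩ h _ h'
    simp only [Finset.mem_sigma, Finset.mem_erase] at h
    exact h.2.1 (congrArg Sigma.fst h')
  · rintro ⟨v, w⟩ h
    simp only [Finset.mem_sigma, Finset.mem_erase] at h ⊢
    exact ⟨h.2.2, h.2.1.symm, h.1⟩
  · rintro ⟨v, w⟩ h
    rfl

theorem InDegree.koszulD {q : ℤ} {c : Finset (Fin n) → N} (hc : InDegree q c) (x : Fin n → R) :
    InDegree (q + 1) (RelReisner.koszulD x c) := by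
  intro F hF
  obtain ⟨v, hv, h⟩ := Finset.exists_ne_zero_of_sum_ne_zero hF
  have h1 := hc (F.erase v) (fun h0 => h (by simp [h0]))
  have := Finset.card_erase_add_one hv
  omega

theorem InDegree.eq_zero_of_neg {q : ℤ} {c : Finset (Fin n) → N} (hc : InDegree q c)
    (hq : q < 0) : c = 0 := by
  ext F
  by_contra h
  have := hc F h
  omega

/-- A homogeneous coboundary is the coboundary of a homogeneous cochain. -/
theorem InDegree.exists_inDegree_koszulD_eq {q : ℤ} {c : Finset (Fin n) → N} (hc : InDegree q c)
    {x : Fin n → R} {e : Finset (Fin n) → N} (he : RelReisner.koszulD x e = c) :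
    ∃ e', InDegree (q - 1) e' ∧ RelReisner.koszulD x e' = c := by
  refine ⟨fun F => if (F.card : ℤ) = q - 1 then e F else 0, fun F h => ?_, ?_⟩
  · by_contra h'
    exact h (if_neg h')
  · ext F
    rw [koszulD_apply]
    by_cases hF : (F.card : ℤ) = q
    · rw [← he, koszulD_apply]
      refine Finset.sum_congr rfl fun v hv => ?_
      have := Finset.card_erase_add_one hv
      rw [if_pos (by omega)]
    · rw [not_not.1 (mt (hc F) hF)]
      refine Finset.sum_eq_zero fun v hv => ?_
      have := Finset.card_erase_add_one hv
      rw [if_neg (by omega), smul_zero, smul_zero]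

/-- Multiplication by `x_v` is null-homotopic on the Koszul complex of `x`. -/
theorem exists_koszulD_eq_smul_of_mem_span {x : Fin n → R} {c : Finset (Fin n) → N}
    (hc : koszulD x c = 0) {r : R} (hr : r ∈ Ideal.span (Set.range x)) :
    ∃ e, koszulD x e = r • c := by
  suffices h : ∀ v, ∃ e, koszulD x e = x v • c by
    induction hr using Submodule.span_induction with
    | mem y hy =>
      obtain ⟨v, rfl⟩ := hy
      exact h v
    | zero => exact ⟨0, by simp⟩
    | add y z _ _ hy hz =>
      obtain ⟨e, he⟩ := hy
      obtain ⟨f, hf⟩ := hz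
      exact ⟨e + f, by rw [map_add, he, hf, add_smul]⟩
    | smul s y _ hy =>
      obtain ⟨e, he⟩ := hy
      exact ⟨s • e, by rw [map_smul, he, smul_assoc]⟩
  intro v
  -- contraction with `v`
  refine ⟨fun F => if v ∈ F then 0 else sgn v F • c (insert v F), ?_⟩
  ext F
  rw [koszulD_apply]
  by_cases hv : v ∈ F
  · rw [Finset.sum_eq_single_of_mem v hv]
    · rw [if_neg (Finset.notMem_erase v F), Finset.insert_erase hv, sgn_erase_self,
        smul_comm (x v), smul_smul, sgn_mul_self, one_smul, Pi.smul_apply]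
    · intro w _ hwv
      rw [if_pos (Finset.mem_erase.2 ⟨hwv.symm, hv⟩), smul_zero, smul_zero]
  · have h0 := congrFun hc (insert v F)
    rw [koszulD_apply, Finset.sum_insert hv, sgn_insert_self, Finset.erase_insert hv,
      Pi.zero_apply] at h0
    have h1 : x v • c F = -(sgn v F • ∑ w ∈ F, sgn w (insert v F) • x w •
        c ((insert v F).erase w)) := by
      rw [← one_smul ℤ (x v • c F), ← sgn_mul_self v F, mul_smul, ← smul_neg,
        eq_neg_of_add_eq_zero_left h0]
    rw [Pi.smul_apply, h1, Finset.smul_sum, ← Finset.sum_neg_distrib]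
    refine Finset.sum_congr rfl fun w hw => ?_
    have hwv : w ≠ v := fun h => hv (h ▸ hw)
    have h2 := sgn_mul_sgn_erase (Finset.mem_insert_self v F) (Finset.mem_insert_of_mem hw) hwv.symm
    rw [sgn_insert_self, Finset.erase_insert hv, Finset.erase_insert_of_ne hwv.symm,
      sgn_insert_self] at h2
    rw [if_neg (fun h => hv (Finset.mem_of_mem_erase h)), Finset.erase_insert_of_ne hwv.symm,
      smul_comm (x w), smul_smul, smul_smul]
    have h3 : sgn w F * sgn v (F.erase w) = -(sgn v F * sgn w (insert v F)) := by
      linear_combination (-(sgn w F * sgn v (F.erase w))) * sgn_mul_self v F +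
        sgn v F * sgn v (F.erase w) * h2 -
        sgn v F * sgn w (insert v F) * sgn_mul_self v (F.erase w)
    rw [h3, neg_smul]

/-! ### Koszul cohomology and regular sequences -/

/-- A regular sequence of length `t` in the radical of `(x_1, …, x_n)` makes the Koszul cohomology
of `x` vanish in the degrees below `t`. -/
theorem exists_koszulD_eq_of_isWeaklyRegular {x : Fin n → R} (rs : List R)
    (hrs : ∀ r ∈ rs, r ∈ (Ideal.span (Set.range x)).radical)
    (hreg : RingTheory.Sequence.IsWeaklyRegular N rs) {q : ℤ} (hq : q < rs.length)
    {c : Finset (Fin n) → N} (hdeg : InDegree q c) (hc : koszulD x c = 0) :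
    ∃ e, koszulD x e = c := by
  induction rs generalizing N q with
  | nil => exact ⟨0, by rw [hdeg.eq_zero_of_neg (by simpa using hq), map_zero]⟩
  | cons r rs ih =>
    rw [RingTheory.Sequence.isWeaklyRegular_cons_iff] at hreg
    obtain ⟨hr, hreg⟩ := hreg
    -- `r` acts injectively on the cohomology in degree `q`, and a power of `r` kills it
    have key : ∀ b : Finset (Fin n) → N, InDegree q b → (∃ e, koszulD x e = r • b) →
        ∃ e, koszulD x e = b := by
      rintro b hb ⟨e, he⟩
      have hrb : InDegree q (r • b) := fun F hF => hb F fun h => hF (by simp [h])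
      obtain ⟨e, hedeg, he⟩ := hrb.exists_inDegree_koszulD_eq he
      let π : N →ₗ[R] QuotSMulTop r N := Submodule.mkQ _
      obtain ⟨f, hf⟩ := ih (N := QuotSMulTop r N) (fun s hs => hrs s (List.mem_cons_of_mem _ hs))
        hreg (q := q - 1) (by rw [List.length_cons] at hq; push_cast at hq; omega)
        (c := fun F => π (e F)) (fun F hF => hedeg F fun h => hF (by simp [h])) (by
          rw [koszulD_comp, he]
          ext F
          exact (Submodule.Quotient.mk_eq_zero _).2
            (Submodule.smul_mem_pointwise_smul _ _ _ trivial))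
      choose f' hf' using fun F => Submodule.mkQ_surjective (r • (⊤ : Submodule R N)) (f F)
      have hg : ∀ F, ∃ z, r • z = e F - koszulD x f' F := by
        intro F
        have h1 : π (e F - koszulD x f' F) = 0 := by
          have h2 := congrFun hf F
          rw [← funext hf'] at h2
          rw [map_sub, ← h2]
          exact sub_eq_zero.2 (congrFun (koszulD_comp π x f') F)
        obtain ⟨z, -, hz⟩ := (Submodule.mem_smul_pointwise_iff_exists _ _ _).1
          ((Submodule.Quotient.mk_eq_zero _).1 h1)
        exact ⟨z, hz⟩
      choose g hg using hg
      refine ⟨g, funext fun F => hr ?_⟩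
      have h1 : r • g = e - koszulD x f' := funext hg
      have h2 : r • koszulD x g = r • b := by
        rw [← map_smul, h1, map_sub, koszulD_koszulD, sub_zero, he]
      exact congrFun h2 F
    obtain ⟨m, hm⟩ := hrs r List.mem_cons_self
    have hpow : ∀ m : ℕ, (∃ e, koszulD x e = r ^ m • c) → ∃ e, koszulD x e = c := by
      intro m
      induction m with
      | zero => simp
      | succ m ihm =>
        intro h
        refine ihm (key _ (fun F hF => hdeg F fun h => hF (by simp [h])) ?_)
        rwa [smul_smul, ← pow_succ']
    exact hpow m (exists_koszulD_eq_smul_of_mem_span hc hm)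

/-- The transition map `K(x^l; N) → K(x^(l+m); N)` between the Koszul complexes of the powers of
`x`, whose colimit computes local cohomology. -/
def koszulTransition (x : Fin n → R) (m : ℕ) (c : Finset (Fin n) → N) : Finset (Fin n) → N :=
  fun F => (∏ v ∈ F, x v ^ m) • c F

theorem koszulD_koszulTransition (x : Fin n → R) (l m : ℕ) (c : Finset (Fin n) → N) :
    koszulD (fun v => x v ^ (l + m)) (koszulTransition x m c) =
      koszulTransition x m (koszulD (fun v => x v ^ l) c) := by
  ext F
  rw [koszulTransition, koszulD_apply, koszulD_apply, Finset.smul_sum]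
  refine Finset.sum_congr rfl fun v hv => ?_
  rw [koszulTransition, smul_comm _ (sgn v F), smul_smul, smul_smul,
    ← Finset.mul_prod_erase F _ hv]
  congr 2
  ring

/-- The colimit over `l` of the Koszul cohomology of `x_1^l, …, x_n^l` vanishes in degree `q`: every
cocycle becomes a coboundary for some larger exponent. -/
def LimitKoszulVanishes (x : Fin n → R) (N : Type*) [AddCommGroup N] [Module R N] (q : ℤ) : Prop :=
  ∀ (l : ℕ) (c : Finset (Fin n) → N), InDegree q c → koszulD (fun v => x v ^ l) c = 0 →
    ∃ (m : ℕ) (e : Finset (Fin n) → N),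
      koszulD (fun v => x v ^ (l + m)) e = koszulTransition x m c

theorem exists_isSMulRegular_of_limitKoszulVanishes [IsNoetherianRing R] [Module.Finite R N]
    {x : Fin n → R} (h : LimitKoszulVanishes x N 0) :
    ∃ r ∈ Ideal.span (Set.range x), IsSMulRegular N r := by
  by_contra! hno
  have hsub : (Ideal.span (Set.range x) : Set R) ⊆
      ⋃ p ∈ ((associatedPrimes.finite R N).toFinset : Set (Ideal R)), (id p : Ideal R) := by
    intro r hr
    have h1 := hno r hr
    rw [isSMulRegular_iff_right_eq_zero_of_smul] at h1
    push Not at h1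
    obtain ⟨y, hy, hy0⟩ := h1
    have h2 : r ∈ {r : R | ∃ x : N, x ≠ 0 ∧ r • x = 0} := ⟨y, hy0, hy⟩
    rw [← biUnion_associatedPrimes_eq_zero_divisors R N] at h2
    simpa using h2
  rw [Ideal.subset_union_prime (f := id) ⊥ ⊥ (fun p hp _ _ =>
    IsAssociatedPrime.isPrime ((associatedPrimes.finite R N).mem_toFinset.1 hp))] at hsub
  obtain ⟨p, hp, hle⟩ := hsub
  obtain ⟨hprime, y, hy⟩ := isAssociatedPrime_iff.1 ((associatedPrimes.finite R N).mem_toFinset.1 hp)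
  have hxy : ∀ v, x v • y = 0 := fun v => by
    have h1 := hle (Ideal.subset_span (Set.mem_range_self v))
    simpa [hy] using h1
  have hy0 : y ≠ 0 := by
    rintro rfl
    exact hprime.ne_top (by rw [hy, Ideal.eq_top_iff_one]; simp)
  obtain ⟨m, e, he⟩ := h 1 (Pi.single ∅ y) (fun F hF => by
    by_contra h'
    refine hF (Pi.single_eq_of_ne ?_ _)
    rintro rfl
    simp at h') (by
      ext F
      rw [koszulD_apply]
      refine Finset.sum_eq_zero fun v _ => ?_
      by_cases hF : F.erase v = ∅
      · rw [hF, Pi.single_eq_same, pow_one, hxy, smul_zero]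
      · rw [Pi.single_eq_of_ne hF, smul_zero, smul_zero])
  have h1 := congrFun he ∅
  simp [koszulD_apply, koszulTransition] at h1
  exact hy0 h1.symm

theorem LimitKoszulVanishes.quotSMulTop {x : Fin n → R} {q : ℤ} {r : R} (hr : IsSMulRegular N r)
    (h0 : LimitKoszulVanishes x N q) (h1 : LimitKoszulVanishes x N (q + 1)) :
    LimitKoszulVanishes x (QuotSMulTop r N) q := by
  intro l c hdeg hc
  let π : N →ₗ[R] QuotSMulTop r N := Submodule.mkQ _
  have hlift : ∀ F, ∃ y, π y = c F ∧ (c F = 0 → y = 0) := by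
    intro F
    by_cases hF : c F = 0
    · exact ⟨0, by simp [hF], fun _ => rfl⟩
    · obtain ⟨y, hy⟩ := Submodule.mkQ_surjective _ (c F)
      exact ⟨y, hy, fun h => absurd h hF⟩
  choose c' hc' hc0 using hlift
  obtain rfl : (fun F => π (c' F)) = c := funext hc'
  have hdeg' : InDegree q c' := fun F hF => hdeg F fun h => hF (hc0 F h)
  have hb : ∀ F, ∃ z, r • z = koszulD (fun v => x v ^ l) c' F := by
    intro F
    rw [koszulD_comp] at hc
    obtain ⟨z, -, hz⟩ := (Submodule.mem_smul_pointwise_iff_exists _ _ _).1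
      ((Submodule.Quotient.mk_eq_zero _).1 (congrFun hc F))
    exact ⟨z, hz⟩
  choose b hb using hb
  have hb : r • b = koszulD (fun v => x v ^ l) c' := funext hb
  have hcancel : ∀ b : Finset (Fin n) → N, r • b = 0 → b = 0 := fun b h =>
    funext fun F => hr (by simpa using congrFun h F)
  have hbdeg : InDegree (q + 1) b := fun F hF => hdeg'.koszulD (fun v => x v ^ l) F (by
    rw [← hb]
    exact fun h => hF (hr (by simpa using h)))
  obtain ⟨m, g, hg⟩ := h1 l b hbdeg (hcancel _ (by rw [← map_smul, hb, koszulD_koszulD]))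
  obtain ⟨g, hgdeg, hg⟩ := InDegree.exists_inDegree_koszulD_eq (q := q + 1)
    (fun F hF => hbdeg F fun h => hF (by simp [koszulTransition, h])) hg
  rw [add_sub_cancel_right] at hgdeg
  obtain ⟨m', e, he⟩ := h0 (l + m) (koszulTransition x m c' - r • g) (fun F hF => by
      by_contra hq
      exact hF (by simp [koszulTransition, not_not.1 (mt (hdeg' F) hq),
        not_not.1 (mt (hgdeg F) hq)])) (by
      rw [map_sub, koszulD_koszulTransition, map_smul, hg, ← hb]
      ext F
      simp only [koszulTransition, Pi.sub_apply, Pi.smul_apply, Pi.zero_apply]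
      rw [smul_comm, sub_self])
  refine ⟨m + m', fun F => π (e F), ?_⟩
  rw [koszulD_comp, ← add_assoc, he]
  ext F
  have h2 : π (r • g F) = 0 := (Submodule.Quotient.mk_eq_zero _).2
    (Submodule.smul_mem_pointwise_smul _ _ _ trivial)
  simp only [koszulTransition, Pi.sub_apply, Pi.smul_apply, map_smul, map_sub]
  rw [← map_smul π r, h2, sub_zero, smul_smul, ← Finset.prod_mul_distrib]
  congr 1
  exact Finset.prod_congr rfl fun v _ => by rw [← pow_add, add_comm]

/-- If the local cohomology with respect to `(x_1, …, x_n)` vanishes in the degrees below `t`, then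
`(x_1, …, x_n)` contains a regular sequence of length `t`. -/
theorem exists_isWeaklyRegular_of_limitKoszulVanishes [IsNoetherianRing R] [Module.Finite R N]
    {x : Fin n → R} (t : ℕ) (h : ∀ q : ℤ, q < t → LimitKoszulVanishes x N q) :
    ∃ rs : List R, rs.length = t ∧ (∀ r ∈ rs, r ∈ Ideal.span (Set.range x)) ∧
      RingTheory.Sequence.IsWeaklyRegular N rs := by
  induction t generalizing N with
  | zero => exact ⟨[], rfl, by simp, .nil R N⟩
  | succ t ih =>
    push_cast at h
    obtain ⟨r, hr, hreg⟩ := exists_isSMulRegular_of_limitKoszulVanishes (h 0 (by omega))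
    obtain ⟨rs, hlen, hmem, hrs⟩ := ih (N := QuotSMulTop r N) fun q hq =>
      (h q (by omega)).quotSMulTop hreg (h (q + 1) (by omega))
    exact ⟨r :: rs, by simp [hlen], by simpa using ⟨hr, hmem⟩, .cons hreg hrs⟩

/-- The dimension of a module bounds the lengths of its regular sequences, over any Noetherian
ring. -/
theorem length_le_supportDim_of_isRegular [IsNoetherianRing R] [Module.Finite R N] (rs : List R)
    (h : RingTheory.Sequence.IsRegular N rs) : (rs.length : WithBot ℕ∞) ≤ Module.supportDim R N := by
  induction rs generalizing N with
  | nil =>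
    have := h.nontrivial
    rw [List.length_nil, Nat.cast_zero]
    exact Order.krullDim_nonneg_iff.2 (Module.nonempty_support_of_nontrivial.to_subtype)
  | cons r rs ih =>
    rw [RingTheory.Sequence.isRegular_cons_iff] at h
    refine le_trans ?_ (Module.supportDim_quotSMulTop_succ_le_of_notMem_minimalPrimes
      (x := r) fun p hp => h.1.notMem_of_mem_minimalPrimes hp)
    rw [List.length_cons, Nat.cast_add, Nat.cast_one]
    gcongr
    exact ih h.2

end Koszul

/-! ### Monomials in monomial ideals -/

section Monomial

variable {k : Type*} [Field k] {n : ℕ}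

/-- The exponent with nonnegative integer entries `a`; negative entries are truncated to `0`. -/
noncomputable def toExponent (a : Fin n → ℤ) : Fin n →₀ ℕ :=
  Finsupp.equivFunOnFinite.symm fun i => (a i).toNat

@[simp]
theorem toExponent_apply (a : Fin n → ℤ) (i : Fin n) : toExponent a i = (a i).toNat := rfl

@[simp]
theorem toExponent_natCast (b : Fin n →₀ ℕ) : toExponent (fun i => (b i : ℤ)) = b := by
  ext i
  simp

theorem natCast_toExponent {a : Fin n → ℤ} (ha : 0 ≤ a) :
    (fun i => (toExponent a i : ℤ)) = a := by
  ext i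
  simpa using ha i

/-- The Laurent monomial with exponent `a` is a monomial of `S` that lies in `K`. -/
def MonomialMem (K : Ideal (MvPolynomial (Fin n) k)) (a : Fin n → ℤ) : Prop :=
  0 ≤ a ∧ monomial (toExponent a) (1 : k) ∈ K

theorem monomial_mem_of_le {K : Ideal (MvPolynomial (Fin n) k)} {b c : Fin n →₀ ℕ} (h : b ≤ c)
    (hb : monomial b (1 : k) ∈ K) : monomial c (1 : k) ∈ K := by
  have h1 := K.mul_mem_left (monomial (c - b) 1) hb
  rwa [monomial_mul, tsub_add_cancel_of_le h, one_mul] at h1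

theorem monomial_mem_of_one {K : Ideal (MvPolynomial (Fin n) k)} {b : Fin n →₀ ℕ}
    (hb : monomial b (1 : k) ∈ K) (r : k) : monomial b r ∈ K := by
  have h1 := K.mul_mem_left (C r) hb
  rwa [C_mul_monomial, mul_one] at h1

theorem MonomialMem.mono {K : Ideal (MvPolynomial (Fin n) k)} {a b : Fin n → ℤ}
    (ha : MonomialMem K a) (h : a ≤ b) : MonomialMem K b :=
  ⟨ha.1.trans h, monomial_mem_of_le (fun i => Int.toNat_le_toNat (h i)) ha.2⟩

theorem IsMonomialIdeal.mem_iff {K : Ideal (MvPolynomial (Fin n) k)} (hK : IsMonomialIdeal K)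
    {f : MvPolynomial (Fin n) k} : f ∈ K ↔ ∀ b ∈ f.support, monomial b (1 : k) ∈ K := by
  constructor
  · obtain ⟨A, rfl⟩ := hK
    intro hf b hb
    rw [mem_ideal_span_monomial_image] at hf ⊢
    intro c hc
    rw [Finset.mem_singleton.1 (support_monomial_subset hc)]
    exact hf b hb
  · intro h
    rw [f.as_sum]
    exact K.sum_mem fun b hb => monomial_mem_of_one (h b hb) _

/-- A monomial ideal is generated by its minimal monomials. -/
theorem monomial_mem_iff_exists_minGenExponents {K : Ideal (MvPolynomial (Fin n) k)}
    {c : Fin n →₀ ℕ} : monomial c (1 : k) ∈ K ↔ ∃ b ∈ minGenExponents K, b ≤ c := by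
  refine ⟨fun h => ?_, fun ⟨b, hb, hbc⟩ => monomial_mem_of_le hbc hb.1⟩
  obtain ⟨b, hbc, hb⟩ := exists_minimal_le_of_wellFoundedLT
    (fun c : Fin n →₀ ℕ => monomial c (1 : k) ∈ K) c h
  exact ⟨b, hb, hbc⟩

/-- The exponent `a + l·1_F`. -/
def shift (a : Fin n → ℤ) (l : ℕ) (F : Finset (Fin n)) : Fin n → ℤ :=
  fun i => a i + if i ∈ F then (l : ℤ) else 0

theorem shift_erase {F : Finset (Fin n)} {v : Fin n} (hv : v ∈ F) (a : Fin n → ℤ) (l : ℕ) :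
    shift a l (F.erase v) = shift a l F - Pi.single v (l : ℤ) := by
  ext i
  by_cases hi : i = v
  · subst hi
    simp [shift, hv]
  · simp [shift, hi]

/-- For large `l`, the monomial `x^(a + l·1_F)` lies in `K` if and only if `x^a` lies in the
localization of `K` at the variables of `F`; in terms of `Δ_a(K)` this says that `F` contains `G_a`
and that `F \ G_a` is not a face. -/
theorem eventually_monomialMem_shift_iff (K : Ideal (MvPolynomial (Fin n) k)) (a : Fin n → ℤ)
    (F : Finset (Fin n)) : ∀ᶠ l : ℕ in Filter.atTop, MonomialMem K (shift a l F) ↔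
      negSupport a ⊆ F ∧ F \ negSupport a ∉ degreeComplex K a := by
  have hface : ∀ h : negSupport a ⊆ F, F \ negSupport a ∉ degreeComplex K a ↔
      ∃ b ∈ minGenExponents K, ∀ i ∉ F, (b i : ℤ) ≤ a i := by
    intro h
    change ¬ (Disjoint _ _ ∧ _) ↔ _
    rw [Finset.sdiff_union_of_subset h]
    simp only [Finset.sdiff_disjoint, true_and]
    push Not
    rfl
  by_cases hG : negSupport a ⊆ F
  · rw [and_iff_right hG, hface hG]
    by_cases hb : ∃ b ∈ minGenExponents K, ∀ i ∉ F, (b i : ℤ) ≤ a i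
    · obtain ⟨b, hb, hba⟩ := hb
      filter_upwards [Filter.eventually_ge_atTop (∑ i, (b i + (a i).natAbs))] with l hl
      refine iff_of_true ?_ ⟨b, hb, hba⟩
      have hle : ∀ i, (b i : ℤ) ≤ shift a l F i := by
        intro i
        have h1 := Finset.single_le_sum (f := fun i => b i + (a i).natAbs) (fun _ _ => Nat.zero_le _)
          (Finset.mem_univ i)
        simp only [shift]
        split_ifs with hi
        · omega
        · simpa using hba i hi
      refine ⟨fun i => (Int.natCast_nonneg _).trans (hle i), ?_⟩
      refine monomial_mem_of_le (fun i => ?_) hb.1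
      have := hle i
      simp
      omega
    · refine Filter.Eventually.of_forall fun l => iff_of_false ?_ hb
      rintro ⟨h0, hl⟩
      obtain ⟨b, hb', hbl⟩ := monomial_mem_iff_exists_minGenExponents.1 hl
      refine hb ⟨b, hb', fun i hi => ?_⟩
      have h1 := hbl i
      have h2 := h0 i
      simp only [shift, toExponent_apply, hi, if_false, Pi.zero_apply] at h1 h2
      omega
  · refine Filter.Eventually.of_forall fun l => iff_of_false ?_ fun h => hG h.1
    rintro ⟨h0, -⟩
    refine hG fun i hi => ?_
    by_contra hiF
    have h1 := h0 i
    simp only [negSupport, Finset.mem_filter] at hi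
    simp only [shift, hiF, if_false, Pi.zero_apply] at h1
    omega

end Monomial

/-! ### The `ℤ^n`-grading of `I/J` -/

section Grading

variable {k : Type*} [Field k] {n : ℕ} {I J : Ideal (MvPolynomial (Fin n) k)}

/-- The graded component of `I/J` in degree `a` is nonzero. -/
def IsDegree (I J : Ideal (MvPolynomial (Fin n) k)) (a : Fin n → ℤ) : Prop :=
  MonomialMem I a ∧ ¬ MonomialMem J a

open Classical in
/-- The coefficient of `x^a` in a member of `I/J`, set to `0` in the degrees in which `I/J`
vanishes. -/
noncomputable def gradedCoeff (hJ : IsMonomialIdeal J) (a : Fin n → ℤ) :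
    (↥I ⧸ Submodule.submoduleOf J I) →+ k :=
  QuotientAddGroup.lift (Submodule.submoduleOf J I).toAddSubgroup
    (if IsDegree I J a then
      (lcoeff k (toExponent a)).toAddMonoidHom.comp I.subtype.toAddMonoidHom else 0) (by
    intro f hf
    split_ifs with h
    · by_contra h0
      exact h.2 ⟨h.1.1, hJ.mem_iff.1 hf _ (mem_support_iff.2 h0)⟩
    · rfl)

open Classical in
theorem gradedCoeff_mk (hJ : IsMonomialIdeal J) (a : Fin n → ℤ) (f : I) :
    gradedCoeff hJ a (Submodule.Quotient.mk (p := Submodule.submoduleOf J I) f) =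
      if IsDegree I J a then coeff (toExponent a) (f : MvPolynomial (Fin n) k) else 0 := by
  change (if IsDegree I J a then (lcoeff k (toExponent a)).toAddMonoidHom.comp
    I.subtype.toAddMonoidHom else 0 : ↥I →+ k) f = _
  split_ifs <;> rfl

theorem gradedCoeff_eq_zero (hJ : IsMonomialIdeal J) {a : Fin n → ℤ} (ha : ¬ IsDegree I J a)
    (m : ↥I ⧸ Submodule.submoduleOf J I) : gradedCoeff hJ a m = 0 := by
  obtain ⟨f, rfl⟩ := Submodule.Quotient.mk_surjective _ m
  rw [gradedCoeff_mk, if_neg ha]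

theorem coeff_eq_zero_of_not_monomialMem (hI : IsMonomialIdeal I) {a : Fin n → ℤ} (h0 : 0 ≤ a)
    (ha : ¬ MonomialMem I a) {f : MvPolynomial (Fin n) k} (hf : f ∈ I) :
    coeff (toExponent a) f = 0 := by
  by_contra h
  exact ha ⟨h0, hI.mem_iff.1 hf _ (mem_support_iff.2 h)⟩

theorem gradedCoeff_injective (hI : IsMonomialIdeal I) (hJ : IsMonomialIdeal J)
    {m m' : ↥I ⧸ Submodule.submoduleOf J I}
    (h : ∀ a, IsDegree I J a → gradedCoeff hJ a m = gradedCoeff hJ a m') : m = m' := by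
  rw [← sub_eq_zero]
  obtain ⟨f, hf⟩ := Submodule.Quotient.mk_surjective _ (m - m')
  rw [← hf, Submodule.Quotient.mk_eq_zero]
  refine hJ.mem_iff.2 fun b hb => ?_
  by_contra hbJ
  have hdeg : IsDegree I J fun i => (b i : ℤ) := by
    refine ⟨⟨fun i => Int.natCast_nonneg _, ?_⟩, fun h => hbJ (by simpa using h.2)⟩
    simpa using hI.mem_iff.1 f.2 b hb
  have h1 := h _ hdeg
  rw [← sub_eq_zero, ← map_sub, ← hf, gradedCoeff_mk, if_pos hdeg, toExponent_natCast] at h1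
  exact mem_support_iff.1 hb h1

theorem finite_gradedCoeff_ne_zero (hJ : IsMonomialIdeal J)
    (m : ↥I ⧸ Submodule.submoduleOf J I) : {a | gradedCoeff hJ a m ≠ 0}.Finite := by
  classical
  obtain ⟨f, rfl⟩ := Submodule.Quotient.mk_surjective _ m
  refine (((f : MvPolynomial (Fin n) k).support.finite_toSet.image
    fun b i => (b i : ℤ))).subset fun a ha => ?_
  simp only [Set.mem_ofPred_eq, gradedCoeff_mk] at ha
  by_cases h : IsDegree I J a
  · rw [if_pos h] at ha
    exact ⟨toExponent a, mem_support_iff.2 ha, natCast_toExponent h.1.1⟩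
  · exact absurd (if_neg h) ha

theorem gradedCoeff_monomial_smul (hI : IsMonomialIdeal I) (hJ : IsMonomialIdeal J)
    (b : Fin n →₀ ℕ) {a : Fin n → ℤ} (ha : IsDegree I J a)
    (m : ↥I ⧸ Submodule.submoduleOf J I) :
    gradedCoeff hJ a (monomial b (1 : k) • m) = gradedCoeff hJ (a - fun i => (b i : ℤ)) m := by
  classical
  obtain ⟨f, rfl⟩ := Submodule.Quotient.mk_surjective _ m
  rw [← Submodule.Quotient.mk_smul, gradedCoeff_mk, gradedCoeff_mk, if_pos ha]
  change coeff _ (monomial b (1 : k) * (f : MvPolynomial (Fin n) k)) = _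
  rw [coeff_monomial_mul', one_mul]
  by_cases hb : b ≤ toExponent a
  · have h0 : (0 : Fin n → ℤ) ≤ a - fun i => (b i : ℤ) := by
      intro i
      have h1 := hb i
      have h2 := ha.1.1 i
      simp only [toExponent_apply, Pi.zero_apply, Pi.sub_apply] at h1 h2 ⊢
      omega
    have h1 : toExponent a - b = toExponent (a - fun i => (b i : ℤ)) := by
      ext i
      simp
    rw [if_pos hb, h1]
    split_ifs with h2
    · rfl
    · by_cases h3 : MonomialMem I (a - fun i => (b i : ℤ))
      · refine absurd (MonomialMem.mono (not_not.1 fun h4 => h2 ⟨h3, h4⟩) ?_) ha.2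
        exact sub_le_self a fun i => Int.natCast_nonneg _
      · exact coeff_eq_zero_of_not_monomialMem hI h0 h3 f.2
  · rw [if_neg hb, if_neg]
    refine fun h => hb fun i => ?_
    have h1 := h.1.1 i
    simp only [Pi.zero_apply, Pi.sub_apply] at h1
    simp
    omega

open Classical in
/-- The class of `c x^a` in `I/J`, set to `0` if `x^a` is not a monomial of `I`. -/
noncomputable def gradedMonomial (I J : Ideal (MvPolynomial (Fin n) k)) (a : Fin n → ℤ) :
    k →+ (↥I ⧸ Submodule.submoduleOf J I) :=
  if h : MonomialMem I a then
    (Submodule.mkQ (Submodule.submoduleOf J I)).toAddMonoidHom.comp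
      (AddMonoidHom.mk' (fun c : k => (⟨monomial (toExponent a) c, monomial_mem_of_one h.2 c⟩ : I))
        fun c e => Subtype.ext (map_add (monomial (toExponent a)) c e))
  else 0

theorem gradedMonomial_apply {a : Fin n → ℤ} (h : MonomialMem I a) (c : k) :
    gradedMonomial I J a c = Submodule.Quotient.mk (p := Submodule.submoduleOf J I)
      ⟨monomial (toExponent a) c, monomial_mem_of_one h.2 c⟩ := by
  rw [gradedMonomial, dif_pos h]
  rfl

theorem gradedMonomial_eq_zero {a : Fin n → ℤ} (ha : ¬ IsDegree I J a) (c : k) :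
    gradedMonomial I J a c = 0 := by
  by_cases h : MonomialMem I a
  · rw [gradedMonomial_apply h, Submodule.Quotient.mk_eq_zero]
    have h1 : MonomialMem J a := not_not.1 fun h' => ha ⟨h, h'⟩
    exact monomial_mem_of_one h1.2 c
  · rw [gradedMonomial, dif_neg h]
    rfl

theorem monomial_smul_gradedMonomial (b : Fin n →₀ ℕ) {a : Fin n → ℤ} (ha : MonomialMem I a)
    (c : k) : monomial b (1 : k) • gradedMonomial I J a c =
      gradedMonomial I J (a + fun i => (b i : ℤ)) c := by
  have h : a ≤ a + fun i => (b i : ℤ) := le_add_of_nonneg_right fun i => Int.natCast_nonneg _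
  rw [gradedMonomial_apply ha, gradedMonomial_apply (ha.mono h), ← Submodule.Quotient.mk_smul]
  congr 1
  refine Subtype.ext ?_
  change monomial b (1 : k) * monomial (toExponent a) c = monomial _ c
  have hexp : b + toExponent a = toExponent (a + fun i => (b i : ℤ)) := by
    ext i
    have := ha.1 i
    simp at this ⊢
    omega
  rw [monomial_mul, one_mul, hexp]

open Classical in
theorem gradedCoeff_gradedMonomial (hJ : IsMonomialIdeal J) {a b : Fin n → ℤ}
    (ha : IsDegree I J a) (c : k) :
    gradedCoeff hJ a (gradedMonomial I J b c) = if a = b then c else 0 := by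
  by_cases hb : IsDegree I J b
  · rw [gradedMonomial_apply hb.1, gradedCoeff_mk, if_pos ha, coeff_monomial]
    refine if_congr ⟨fun h => ?_, fun h => by rw [h]⟩ rfl rfl
    rw [← natCast_toExponent ha.1.1, ← natCast_toExponent hb.1.1, h]
  · rw [gradedMonomial_eq_zero hb, map_zero, if_neg]
    rintro rfl
    exact hb ha

/-- An element with constant term `1` kills `I/J` only if `I/J = 0`: it does not change the
coefficient at a monomial of `I` that it is multiplied with. -/
theorem le_of_smul_eq_zero (hI : IsMonomialIdeal I) (hJ : IsMonomialIdeal J)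
    {r : MvPolynomial (Fin n) k} (hr : r - 1 ∈ idealOfVars (Fin n) k)
    (h : ∀ f ∈ I, r * f ∈ J) : I ≤ J := by
  have hr0 : coeff 0 r = 1 := by
    have h1 : constantCoeff (r - 1) = 0 := by
      have h2 : idealOfVars (Fin n) k ≤ RingHom.ker (constantCoeff (σ := Fin n) (R := k)) := by
        rw [idealOfVars, Ideal.span_le]
        rintro _ ⟨i, rfl⟩
        exact constantCoeff_X k i
      exact h2 hr
    rw [map_sub, map_one, sub_eq_zero] at h1
    exact h1
  intro f hf
  refine hJ.mem_iff.2 fun b hb => ?_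
  have hbI := hI.mem_iff.1 hf b hb
  refine hJ.mem_iff.1 (h _ hbI) b (mem_support_iff.2 ?_)
  rw [coeff_mul_monomial', if_pos le_rfl, tsub_self, hr0]
  simp

end Grading

/-! ### The graded components of the Koszul complexes of `I/J` -/

section Family

variable {n : ℕ}

/-- The cohomology, in the degree of the sets with `q` elements, of the cochains supported on a
family `P` of sets vanishes. For `P = Δ \ Γ` these are the relative cochains of `(Δ, Γ)`. -/
def FamilyVanishes (k : Type*) [Field k] (P : Finset (Fin n) → Prop) (q : ℤ) : Prop :=
  ∀ c : Finset (Fin n) → k, InDegree q c → (∀ F, c F ≠ 0 → P F) →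
    (∀ F, P F → koszulD (fun _ => (1 : k)) c F = 0) →
    ∃ e : Finset (Fin n) → k, (∀ F, e F ≠ 0 → P F) ∧
      ∀ F, P F → koszulD (fun _ => (1 : k)) e F = c F

/-- Joining every member of a family with a fixed disjoint set `G` shifts the degree by `|G|`. -/
theorem familyVanishes_union_iff (k : Type*) [Field k] {P : Finset (Fin n) → Prop}
    {G : Finset (Fin n)} (hP : ∀ F, P F → Disjoint F G) (q : ℤ) :
    FamilyVanishes k (fun F => G ⊆ F ∧ P (F \ G)) (q + G.card) ↔ FamilyVanishes k P q := by
  -- the sign of the shuffle that moves the members of `G` to the front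
  let ε : Finset (Fin n) → ℤ := fun F => ∏ w ∈ F, sgn w G
  have hε2 : ∀ F, ε F * ε F = 1 := fun F => by
    simp only [ε]
    rw [← Finset.prod_mul_distrib]
    exact Finset.prod_eq_one fun w _ => sgn_mul_self w G
  have hsgn : ∀ F, Disjoint F G → ∀ v ∈ F,
      sgn v (F ∪ G) * ε (F.erase v) = ε F * sgn v F := by
    intro F hF v hv
    have h1 : sgn v (F ∪ G) = sgn v F * sgn v G := Finset.prod_union hF
    have h2 : sgn v G * ε (F.erase v) = ε F := Finset.mul_prod_erase F (fun w => sgn w G) hv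
    rw [h1, ← h2]
    ring
  have herase : ∀ F, Disjoint F G → ∀ v ∈ F, (F ∪ G).erase v = F.erase v ∪ G := by
    intro F hF v hv
    rw [Finset.erase_union_distrib, Finset.erase_eq_of_notMem (Finset.disjoint_left.1 hF hv)]
  have hcancel : ∀ F, Disjoint F G → (F ∪ G) \ G = F := fun F hF => by
    rw [Finset.union_sdiff_right, Finset.sdiff_eq_self_of_disjoint hF]
  -- the two coboundaries correspond to each other
  have key : ∀ c b : Finset (Fin n) → k, (∀ F, c F ≠ 0 → G ⊆ F) →
      (∀ F, Disjoint F G → c (F ∪ G) = ε F • b F) → ∀ F, Disjoint F G →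
      koszulD (fun _ => (1 : k)) c (F ∪ G) = ε F • koszulD (fun _ => (1 : k)) b F := by
    intro c b hc hcb F hF
    rw [koszulD_apply, koszulD_apply, Finset.sum_union hF, Finset.smul_sum,
      Finset.sum_eq_zero (s := G), add_zero]
    · refine Finset.sum_congr rfl fun v hv => ?_
      rw [herase F hF v hv, one_smul, one_smul, hcb _ (hF.mono_left (Finset.erase_subset v F)),
        smul_smul, smul_smul, hsgn F hF v hv]
    · intro v hv
      rw [not_not.1 (mt (hc _) fun h => Finset.notMem_erase v _ (h hv)), smul_zero, smul_zero]
  have hsmul : ∀ F (y : k), ε F • ε F • y = y := fun F y => by rw [smul_smul, hε2, one_smul]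
  let join : (Finset (Fin n) → k) → Finset (Fin n) → k :=
    fun c F => if G ⊆ F then ε (F \ G) • c (F \ G) else 0
  have join_ne : ∀ c F, join c F ≠ 0 → G ⊆ F ∧ c (F \ G) ≠ 0 := by
    intro c F hF
    by_cases hG : G ⊆ F
    · exact ⟨hG, fun h => hF (by simp [join, h])⟩
    · exact absurd (if_neg hG) hF
  have join_union : ∀ c F, Disjoint F G → join c (F ∪ G) = ε F • c F := fun c F hF => by
    simp only [join]
    rw [if_pos Finset.subset_union_right, hcancel F hF]
  let cut : (Finset (Fin n) → k) → Finset (Fin n) → k :=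
    fun c F => if Disjoint F G then ε F • c (F ∪ G) else 0
  have cut_ne : ∀ c F, cut c F ≠ 0 → Disjoint F G ∧ c (F ∪ G) ≠ 0 := by
    intro c F hF
    by_cases hG : Disjoint F G
    · exact ⟨hG, fun h => hF (by simp [cut, h])⟩
    · exact absurd (if_neg hG) hF
  have cut_union : ∀ c F, Disjoint F G → c (F ∪ G) = ε F • cut c F := fun c F hF => by
    simp only [cut]
    rw [if_pos hF, hsmul]
  constructor
  · intro h c hdeg hc hd
    obtain ⟨e, he, hde⟩ := h (join c) (fun F hF => by
        obtain ⟨hG, hF⟩ := join_ne c F hF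
        have h1 := hdeg _ hF
        have h2 := Finset.card_sdiff_add_card_eq_card hG
        omega) (fun F hF => ⟨(join_ne c F hF).1, hc _ (join_ne c F hF).2⟩) (fun F hF => by
        rw [← Finset.sdiff_union_of_subset hF.1, key (join c) c (fun F hF => (join_ne c F hF).1)
          (join_union c) _ Finset.sdiff_disjoint, hd _ hF.2, smul_zero])
    refine ⟨cut e, fun F hF => ?_, fun F hF => ?_⟩
    · have h1 := (he _ (cut_ne e F hF).2).2
      rwa [hcancel F (cut_ne e F hF).1] at h1
    · have h1 := hde (F ∪ G) ⟨Finset.subset_union_right, by rwa [hcancel F (hP F hF)]⟩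
      rw [key e (cut e) (fun F hF => (he F hF).1) (cut_union e) F (hP F hF),
        join_union c F (hP F hF)] at h1
      rw [← hsmul F (koszulD _ _ F), h1, hsmul]
  · intro h c hdeg hc hd
    have hcG : ∀ F, c F ≠ 0 → G ⊆ F := fun F hF => (hc F hF).1
    obtain ⟨e, he, hde⟩ := h (cut c) (fun F hF => by
        obtain ⟨hG, hF⟩ := cut_ne c F hF
        have h1 := hdeg _ hF
        rw [Finset.card_union_of_disjoint hG] at h1
        omega) (fun F hF => by
        have h1 := (hc _ (cut_ne c F hF).2).2
        rwa [hcancel F (cut_ne c F hF).1] at h1) (fun F hF => by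
        rw [← hsmul F (koszulD _ _ F), ← key c (cut c) hcG (cut_union c) F (hP F hF), hd,
          smul_zero]
        exact ⟨Finset.subset_union_right, by rwa [hcancel F (hP F hF)]⟩)
    refine ⟨join e, fun F hF => ⟨(join_ne e F hF).1, he _ (join_ne e F hF).2⟩, fun F hF => ?_⟩
    rw [← Finset.sdiff_union_of_subset hF.1, key (join e) e (fun F hF => (join_ne e F hF).1)
      (join_union e) _ Finset.sdiff_disjoint, hde _ hF.2,
      ← cut_union c _ Finset.sdiff_disjoint]

end Family

section KoszulComponents

variable {k : Type*} [Field k] {n : ℕ} {I J : Ideal (MvPolynomial (Fin n) k)}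

theorem gradedCoeff_prod_X_pow_smul (hI : IsMonomialIdeal I) (hJ : IsMonomialIdeal J)
    {a : Fin n → ℤ} {l m : ℕ} {F : Finset (Fin n)} (h : IsDegree I J (shift a (l + m) F))
    (y : ↥I ⧸ Submodule.submoduleOf J I) :
    gradedCoeff hJ (shift a (l + m) F) ((∏ v ∈ F, (X v : MvPolynomial (Fin n) k) ^ m) • y) =
      gradedCoeff hJ (shift a l F) y := by
  have h1 : ∏ v ∈ F, (X v : MvPolynomial (Fin n) k) ^ m =
      monomial (∑ v ∈ F, Finsupp.single v m) 1 := by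
    rw [monomial_sum_one]
    exact Finset.prod_congr rfl fun v _ => X_pow_eq_monomial
  rw [h1, gradedCoeff_monomial_smul hI hJ _ h]
  congr 2
  ext i
  simp only [shift, Pi.sub_apply, Finsupp.finsetSum_apply, Finsupp.single_apply,
    Finset.sum_ite_eq']
  split_ifs <;> push_cast <;> ring

/-- The coefficients in degree `a` identify the differential of the Koszul complex of
`x_1^l, …, x_n^l` with the coboundary of the family of the `F` for which `x^(a + l·1_F)` is a
monomial of `I` that is not in `J`. -/
theorem gradedCoeff_koszulD (hI : IsMonomialIdeal I) (hJ : IsMonomialIdeal J) {a : Fin n → ℤ}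
    {l : ℕ} {F : Finset (Fin n)} (h : IsDegree I J (shift a l F))
    (c : Finset (Fin n) → ↥I ⧸ Submodule.submoduleOf J I) :
    gradedCoeff hJ (shift a l F)
        (koszulD (fun v => (X v : MvPolynomial (Fin n) k) ^ l) c F) =
      koszulD (fun _ => (1 : k)) (fun F => gradedCoeff hJ (shift a l F) (c F)) F := by
  rw [koszulD_apply, koszulD_apply, map_sum]
  refine Finset.sum_congr rfl fun v hv => ?_
  rw [map_zsmul, X_pow_eq_monomial, gradedCoeff_monomial_smul hI hJ _ h, one_smul,
    shift_erase hv]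
  congr 4
  ext i
  by_cases hi : i = v
  · subst hi
    simp
  · simp [hi]

theorem koszulD_gradedMonomial {a : Fin n → ℤ} {l : ℕ} {c : Finset (Fin n) → k}
    (hc : ∀ F, c F ≠ 0 → IsDegree I J (shift a l F)) (F : Finset (Fin n)) :
    koszulD (fun v => (X v : MvPolynomial (Fin n) k) ^ l)
        (fun F => gradedMonomial I J (shift a l F) (c F)) F =
      gradedMonomial I J (shift a l F) (koszulD (fun _ => (1 : k)) c F) := by
  rw [koszulD_apply, koszulD_apply, map_sum]
  refine Finset.sum_congr rfl fun v hv => ?_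
  rw [map_zsmul, one_smul]
  by_cases h : c (F.erase v) = 0
  · rw [h, map_zero, map_zero, smul_zero]
  · rw [X_pow_eq_monomial, monomial_smul_gradedMonomial _ (hc _ h).1, shift_erase hv]
    congr 3
    ext i
    by_cases hi : i = v
    · subst hi
      simp
    · simp [hi]

/-- If the Koszul cohomology of the powers of the variables vanishes on `I/J`, so does the
cohomology of each of its graded components. -/
theorem familyVanishes_isDegree (hI : IsMonomialIdeal I) (hJ : IsMonomialIdeal J) {l : ℕ} {q : ℤ}
    (h : ∀ c : Finset (Fin n) → ↥I ⧸ Submodule.submoduleOf J I, InDegree q c →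
      koszulD (fun v => (X v : MvPolynomial (Fin n) k) ^ l) c = 0 →
      ∃ e, koszulD (fun v => (X v : MvPolynomial (Fin n) k) ^ l) e = c) (a : Fin n → ℤ) :
    FamilyVanishes k (fun F => IsDegree I J (shift a l F)) q := by
  intro c hdeg hc hd
  obtain ⟨e, he⟩ := h (fun F => gradedMonomial I J (shift a l F) (c F))
    (fun F hF => hdeg F fun h => hF (by simp [h])) (by
      ext F
      rw [koszulD_gradedMonomial hc]
      by_cases hF : IsDegree I J (shift a l F)
      · rw [hd F hF, map_zero]
        rfl
      · exact gradedMonomial_eq_zero hF _)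
  refine ⟨fun F => gradedCoeff hJ (shift a l F) (e F),
    fun F hF => not_not.1 fun h => hF (gradedCoeff_eq_zero hJ h _), fun F hF => ?_⟩
  rw [← gradedCoeff_koszulD hI hJ hF, he, gradedCoeff_gradedMonomial hJ hF, if_pos rfl]

/-- For large `l`, the graded component of degree `a` of the Koszul complex of `x_1^l, …, x_n^l` is
the relative cochain complex of `(Δ_a(J), Δ_a(I))`, shifted by `G_a`. -/
theorem eventually_isDegree_shift_iff (I J : Ideal (MvPolynomial (Fin n) k)) (a : Fin n → ℤ) :
    ∀ᶠ l : ℕ in Filter.atTop, ∀ F, IsDegree I J (shift a l F) ↔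
      negSupport a ⊆ F ∧ (F \ negSupport a ∈ degreeComplex J a ∧
        F \ negSupport a ∉ degreeComplex I a) := by
  rw [Filter.eventually_all]
  intro F
  filter_upwards [eventually_monomialMem_shift_iff I a F,
    eventually_monomialMem_shift_iff J a F] with l h1 h2
  rw [IsDegree, h1, h2]
  tauto

/-- The local cohomology of `I/J` vanishes if it does so in every degree of the `ℤ^n`-grading. -/
theorem limitKoszulVanishes_of_familyVanishes (hI : IsMonomialIdeal I) (hJ : IsMonomialIdeal J)
    {q : ℤ} (h : ∀ a, FamilyVanishes k (fun F => negSupport a ⊆ F ∧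
      (F \ negSupport a ∈ degreeComplex J a ∧ F \ negSupport a ∉ degreeComplex I a)) q) :
    LimitKoszulVanishes (X : Fin n → MvPolynomial (Fin n) k)
      (↥I ⧸ Submodule.submoduleOf J I) q := by
  classical
  intro l c hdeg hc
  -- the degrees of the nonzero components of `c`
  have hfin : {a : Fin n → ℤ | ∃ F, gradedCoeff hJ (shift a l F) (c F) ≠ 0}.Finite := by
    rw [Set.ofPred_exists]
    refine Set.finite_iUnion fun F => ?_
    refine (finite_gradedCoeff_ne_zero hJ (c F)).preimage (f := fun a => shift a l F) ?_
    intro a _ b _ hab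
    ext i
    simpa [shift] using congrFun hab i
  set A := hfin.toFinset with hA
  obtain ⟨M, hM, hlM⟩ := (((Filter.eventually_all_finset A).2 fun a _ =>
    eventually_isDegree_shift_iff I J a).and (Filter.eventually_ge_atTop l)).exists
  obtain ⟨m, rfl⟩ := Nat.exists_eq_add_of_le hlM
  let x : Fin n → MvPolynomial (Fin n) k := fun v => X v ^ (l + m)
  let c' := koszulTransition (X : Fin n → MvPolynomial (Fin n) k) m c
  have hc' : koszulD x c' = 0 := by
    rw [koszulD_koszulTransition, hc]
    ext F
    exact smul_zero _
  have hcoeff : ∀ a F, gradedCoeff hJ (shift a (l + m) F) (c' F) ≠ 0 → a ∈ A := by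
    intro a F hF
    refine hfin.mem_toFinset.2 ⟨F, ?_⟩
    rwa [← gradedCoeff_prod_X_pow_smul hI hJ (m := m)
      (not_not.1 fun h => hF (gradedCoeff_eq_zero hJ h _))]
  have hsolve : ∀ a, ∃ e : Finset (Fin n) → k,
      a ∈ A → (∀ F, e F ≠ 0 → IsDegree I J (shift a (l + m) F)) ∧
        ∀ F, IsDegree I J (shift a (l + m) F) → koszulD (fun _ => (1 : k)) e F =
          gradedCoeff hJ (shift a (l + m) F) (c' F) := by
    intro a
    by_cases ha : a ∈ A
    · obtain ⟨e, he⟩ := h a (fun F => gradedCoeff hJ (shift a (l + m) F) (c' F))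
        (fun F hF => hdeg F fun h => hF (by simp [c', koszulTransition, h]))
        (fun F hF => (hM a ha F).1 (not_not.1 fun h => hF (gradedCoeff_eq_zero hJ h _)))
        (fun F hF => by
          rw [← gradedCoeff_koszulD hI hJ ((hM a ha F).2 hF)]
          change gradedCoeff hJ _ (koszulD x c' F) = 0
          rw [hc']
          exact map_zero _)
      exact ⟨e, fun _ => ⟨fun F hF => (hM a ha F).2 (he.1 F hF),
        fun F hF => he.2 F ((hM a ha F).1 hF)⟩⟩
    · exact ⟨0, fun h => absurd h ha⟩
  choose e he using hsolve
  refine ⟨m, ∑ a ∈ A, fun F => gradedMonomial I J (shift a (l + m) F) (e a F), ?_⟩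
  ext F
  rw [map_sum, Finset.sum_apply]
  refine gradedCoeff_injective hI hJ fun b hb => ?_
  -- every degree has the form `a + (l + m)·1_F`, for the set `F` at which `dE` is evaluated
  obtain ⟨a, rfl⟩ : ∃ a, shift a (l + m) F = b :=
    ⟨fun i => b i - if i ∈ F then ((l + m : ℕ) : ℤ) else 0, by ext i; simp [shift]⟩
  have hinj : ∀ a', shift a (l + m) F = shift a' (l + m) F ↔ a = a' := fun a' =>
    ⟨fun h => funext fun i => by simpa [shift] using congrFun h i, fun h => by rw [h]⟩
  rw [map_sum]
  have h1 : ∀ a' ∈ A, gradedCoeff hJ (shift a (l + m) F) (koszulD x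
      (fun F => gradedMonomial I J (shift a' (l + m) F) (e a' F)) F) =
      if a = a' then koszulD (fun _ => (1 : k)) (e a') F else 0 := by
    intro a' ha'
    rw [koszulD_gradedMonomial (he a' ha').1, gradedCoeff_gradedMonomial hJ hb]
    simp only [hinj]
  rw [Finset.sum_congr rfl h1, Finset.sum_ite_eq]
  split_ifs with ha
  · exact (he a ha).2 F hb
  · by_contra hne
    exact ha (hcoeff a F (Ne.symm hne))

end KoszulComponents

/-! ### Relative cohomology in terms of functions on the faces -/

section Cohomology

variable {n : ℕ}

theorem boundary_single (F : Finset (Fin n)) :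
    boundary n (Finsupp.single F 1) = ∑ v ∈ F, sgn v F • Finsupp.single (F.erase v) (1 : ℤ) := by
  rw [boundary, Finsupp.linearCombination_single, one_smul]
  refine Finset.sum_congr rfl fun v _ => ?_
  rw [Finsupp.smul_single, smul_eq_mul, mul_one, sgn_eq_pow]

/-- The face `F` as a chain of `Δ`. -/
noncomputable def faceChain (Δ : Complex n) {j : ℤ} (F : Finset (Fin n)) (h : F ∈ Δ)
    (hj : (F.card : ℤ) = j + 1) : chains Δ j :=
  ⟨Finsupp.single F 1, Finsupp.single_mem_supported ℤ 1 ⟨h, hj⟩⟩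

variable (k : Type*) [Field k]

open Classical in
/-- The value of a relative cochain on a face; it is `0` on the sets that are not faces of
dimension `j`. -/
noncomputable def cochainFun {Δ Γ : Complex n} {j : ℤ} (f : relChains Δ Γ j →ₗ[ℤ] k)
    (F : Finset (Fin n)) : k :=
  if h : F ∈ Δ ∧ (F.card : ℤ) = j + 1 then f (Submodule.Quotient.mk (faceChain Δ F h.1 h.2)) else 0

/-- The relative cochain with prescribed values on the faces. -/
noncomputable def cochainOfFun {Δ Γ : Complex n} (j : ℤ) (c : Finset (Fin n) → k)
    (hc : ∀ F ∈ Γ, c F = 0) : relChains Δ Γ j →ₗ[ℤ] k :=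
  Submodule.liftQ _ ((Finsupp.linearCombination ℤ c).comp (chains Δ j).subtype) (by
    intro z hz
    change Finsupp.linearCombination ℤ c (z : Finset (Fin n) →₀ ℤ) = 0
    rw [Finsupp.linearCombination_apply]
    refine Finset.sum_eq_zero fun F hF => ?_
    have h1 := ((Finsupp.mem_supported _ _).1 (show (z : Finset (Fin n) →₀ ℤ) ∈ chains Γ j from hz)
      hF).1
    simp only [hc F h1, smul_zero])

variable {k}

theorem cochainFun_apply {Δ Γ : Complex n} {j : ℤ} (f : relChains Δ Γ j →ₗ[ℤ] k)
    {F : Finset (Fin n)} (h : F ∈ Δ) (hj : (F.card : ℤ) = j + 1) :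
    cochainFun k f F = f (Submodule.Quotient.mk (faceChain Δ F h hj)) := dif_pos ⟨h, hj⟩

theorem cochainOfFun_faceChain {Δ Γ : Complex n} {j : ℤ} (c : Finset (Fin n) → k)
    (hc : ∀ F ∈ Γ, c F = 0) {F : Finset (Fin n)} (h : F ∈ Δ) (hj : (F.card : ℤ) = j + 1) :
    cochainOfFun (Δ := Δ) k j c hc (Submodule.Quotient.mk (faceChain Δ F h hj)) = c F := by
  change Finsupp.linearCombination ℤ c (Finsupp.single F 1) = c F
  rw [Finsupp.linearCombination_single, one_smul]

theorem cochainFun_ne_zero {Δ Γ : Complex n} {j : ℤ} {f : relChains Δ Γ j →ₗ[ℤ] k}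
    {F : Finset (Fin n)} (h : cochainFun k f F ≠ 0) :
    (F ∈ Δ ∧ F ∉ Γ) ∧ (F.card : ℤ) = j + 1 := by
  by_cases hF : F ∈ Δ ∧ (F.card : ℤ) = j + 1
  · refine ⟨⟨hF.1, fun hΓ => h ?_⟩, hF.2⟩
    rw [cochainFun_apply f hF.1 hF.2, (Submodule.Quotient.mk_eq_zero _).2, map_zero]
    exact Finsupp.single_mem_supported ℤ 1 ⟨hΓ, hF.2⟩
  · exact absurd (dif_neg hF) h

/-- Relative cochains are determined by their values on the faces. -/
theorem cochain_ext {Δ Γ : Complex n} {j : ℤ} {f g : relChains Δ Γ j →ₗ[ℤ] k}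
    (h : ∀ F, F ∈ Δ → F ∉ Γ → (F.card : ℤ) = j + 1 → cochainFun k f F = cochainFun k g F) :
    f = g := by
  have hall : ∀ F, cochainFun k f F = cochainFun k g F := by
    intro F
    by_contra hne
    have h1 : cochainFun k f F ≠ 0 ∨ cochainFun k g F ≠ 0 := by
      by_contra! h0
      exact hne (h0.1.trans h0.2.symm)
    rcases h1 with h1 | h1 <;> obtain ⟨⟨h2, h3⟩, h4⟩ := cochainFun_ne_zero h1 <;>
      exact hne (h F h2 h3 h4)
  refine LinearMap.ext fun z => ?_
  obtain ⟨⟨z, hz⟩, rfl⟩ := Submodule.Quotient.mk_surjective _ z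
  have hmem : ∀ F ∈ z.support, F ∈ Δ ∧ (F.card : ℤ) = j + 1 := fun F hF =>
    (Finsupp.mem_supported _ _).1 hz hF
  have hsum : (⟨z, hz⟩ : chains Δ j) = ∑ F ∈ z.support.attach,
      z F • faceChain Δ (F : Finset (Fin n)) (hmem F F.2).1 (hmem F F.2).2 := by
    refine Subtype.ext ?_
    rw [AddSubmonoidClass.coe_finsetSum]
    refine (Finsupp.sum_single z).symm.trans ?_
    rw [Finsupp.sum, ← Finset.sum_attach]
    refine Finset.sum_congr rfl fun F _ => ?_
    change _ = z F • Finsupp.single (F : Finset (Fin n)) (1 : ℤ)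
    rw [Finsupp.smul_single, smul_eq_mul, mul_one]
  change f (Submodule.mkQ _ _) = g (Submodule.mkQ _ _)
  rw [hsum]
  simp only [map_sum, map_smul]
  refine Finset.sum_congr rfl fun F _ => ?_
  have h1 := hall F
  rw [cochainFun_apply f (hmem F F.2).1 (hmem F F.2).2,
    cochainFun_apply g (hmem F F.2).1 (hmem F F.2).2] at h1
  exact congrArg (z F • ·) h1

theorem cochainFun_relCoboundary {Δ Γ : Complex n} {i j : ℤ} (h : i + 1 = j)
    (f : relChains Δ Γ i →ₗ[ℤ] k) {F : Finset (Fin n)} (hF : F ∈ Δ) (hj : (F.card : ℤ) = j + 1) :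
    cochainFun k (relCoboundary k Δ Γ h f) F =
      koszulD (fun _ => (1 : k)) (cochainFun k f) F := by
  rw [cochainFun_apply _ hF hj, koszulD_apply]
  have hface : ∀ v ∈ F, F.erase v ∈ Δ ∧ ((F.erase v).card : ℤ) = i + 1 := fun v hv =>
    ⟨Δ.lower (Finset.erase_subset v F) hF, by have := Finset.card_erase_add_one hv; omega⟩
  have h1 : chainsBoundary Δ h (faceChain Δ F hF hj) = ∑ v ∈ F.attach, sgn (v : Fin n) F •
      faceChain Δ (F.erase v) (hface v v.2).1 (hface v v.2).2 := by
    refine Subtype.ext ?_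
    rw [AddSubmonoidClass.coe_finsetSum]
    change boundary n (Finsupp.single F 1) = _
    rw [boundary_single, ← Finset.sum_attach]
    rfl
  change f (Submodule.mkQ _ (chainsBoundary Δ h (faceChain Δ F hF hj))) = _
  rw [h1, map_sum, map_sum, ← Finset.sum_attach F]
  refine Finset.sum_congr rfl fun v _ => ?_
  rw [map_smul, map_smul, one_smul, cochainFun_apply f (hface v v.2).1 (hface v v.2).2]
  rfl

theorem subsingleton_reducedRelCohomology_iff (Δ Γ : Complex n) (j : ℤ) :
    Subsingleton (ReducedRelCohomology k Δ Γ j) ↔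
      FamilyVanishes k (fun F => F ∈ Δ ∧ F ∉ Γ) (j + 1) := by
  rw [Submodule.Quotient.subsingleton_iff, Submodule.submoduleOf_eq_top]
  constructor
  · intro h c hdeg hc hd
    have hcΓ : ∀ F ∈ Γ, c F = 0 := fun F hF => by
      by_contra h0
      exact (hc F h0).2 hF
    have hfun : cochainFun k (cochainOfFun (Δ := Δ) k j c hcΓ) = c := by
      ext F
      by_cases hF : F ∈ Δ ∧ (F.card : ℤ) = j + 1
      · rw [cochainFun_apply _ hF.1 hF.2, cochainOfFun_faceChain]
      · rw [cochainFun, dif_neg hF]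
        by_contra h0
        exact hF ⟨(hc F (Ne.symm h0)).1, hdeg F (Ne.symm h0)⟩
    obtain ⟨g, hg⟩ := h (show cochainOfFun (Δ := Δ) k j c hcΓ ∈ _ from by
      rw [LinearMap.mem_ker]
      refine cochain_ext fun F hF hFΓ hcard => ?_
      rw [cochainFun_relCoboundary _ _ hF hcard, hfun, hd F ⟨hF, hFΓ⟩,
        cochainFun_apply _ hF hcard]
      rfl)
    refine ⟨cochainFun k g, fun F hF => (cochainFun_ne_zero hF).1, fun F hF => ?_⟩
    by_cases hcard : (F.card : ℤ) = j + 1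
    · rw [← cochainFun_relCoboundary (sub_add_cancel j 1) g hF.1 hcard, hg, hfun]
    · rw [not_not.1 (mt (hdeg F) hcard)]
      by_contra h0
      have h1 : InDegree (j - 1 + 1) (cochainFun k g) := fun F hF => (cochainFun_ne_zero hF).2
      have h2 := h1.koszulD (fun _ => (1 : k)) F h0
      omega
  · intro h f hf
    rw [LinearMap.mem_ker] at hf
    obtain ⟨e, he, hde⟩ := h (cochainFun k f) (fun F hF => (cochainFun_ne_zero hF).2)
      (fun F hF => (cochainFun_ne_zero hF).1) (fun F hF => by
        by_contra h0
        have h1 : InDegree (j + 1) (cochainFun k f) := fun F hF => (cochainFun_ne_zero hF).2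
        have h2 := h1.koszulD (fun _ => (1 : k)) F h0
        rw [← cochainFun_relCoboundary rfl f hF.1 h2, hf, cochainFun_apply _ hF.1 h2] at h0
        exact h0 rfl)
    have heΓ : ∀ F ∈ Γ, e F = 0 := fun F hF => by
      by_contra h0
      exact (he F h0).2 hF
    refine ⟨cochainOfFun (Δ := Δ) k (j - 1) e heΓ, cochain_ext fun F hF hFΓ hcard => ?_⟩
    rw [cochainFun_relCoboundary _ _ hF hcard, ← hde F ⟨hF, hFΓ⟩, koszulD_apply, koszulD_apply]
    refine Finset.sum_congr rfl fun v hv => ?_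
    have h1 : ((F.erase v).card : ℤ) = j - 1 + 1 := by
      have := Finset.card_erase_add_one hv
      omega
    rw [cochainFun_apply _ (Δ.lower (Finset.erase_subset v F) hF) h1, cochainOfFun_faceChain]

end Cohomology

/-! ### Links as degree complexes -/

section Criterion

variable {k : Type*} [Field k] {n : ℕ}

/-- The exponent `a` with the entries at `F` replaced by `-1`. -/
def negOn (a : Fin n → ℤ) (F : Finset (Fin n)) : Fin n → ℤ := fun i => if i ∈ F then -1 else a i

theorem negSupport_negOn (a : Fin n → ℤ) (F : Finset (Fin n)) :
    negSupport (negOn a F) = F ∪ negSupport a := by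
  ext i
  rw [Finset.mem_union]
  refine Finset.mem_filter.trans (Iff.trans ?_ (or_congr_right Finset.mem_filter.symm))
  by_cases h : i ∈ F <;> simp [negOn, h]

/-- The links of a degree complex are again degree complexes. -/
theorem link_degreeComplex (K : Ideal (MvPolynomial (Fin n) k)) {a : Fin n → ℤ}
    {F : Finset (Fin n)} (hF : Disjoint F (negSupport a)) :
    link (degreeComplex K a) F = degreeComplex K (negOn a F) := by
  refine SetLike.ext fun H => ?_
  change (Disjoint H F ∧ Disjoint (H ∪ F) (negSupport a) ∧ _) ↔ (Disjoint H _ ∧ _)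
  rw [negSupport_negOn, Finset.disjoint_union_left, Finset.disjoint_union_right,
    and_iff_left hF, ← and_assoc, Finset.union_assoc]
  refine and_congr_right fun _ => forall₂_congr fun b _ => exists_congr fun i =>
    and_congr_right fun hi => ?_
  have hiF : i ∉ F := fun h => hi (by simp [h])
  simp [negOn, hiF]

/-- The criterion with links in terms of the degree complexes themselves. -/
theorem forall_link_iff_forall_degreeComplex (I J : Ideal (MvPolynomial (Fin n) k)) (d : ℤ) :
    (∀ a : Fin n → ℤ, ∀ F ∈ degreeComplex J a, ∀ j : ℤ,
        j < d - ((negSupport a).card : ℤ) - (F.card : ℤ) - 1 →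
        Subsingleton (ReducedRelCohomology k (link (degreeComplex J a) F)
          (link (degreeComplex I a) F) j)) ↔
      ∀ a : Fin n → ℤ, ∀ q : ℤ, q < d → FamilyVanishes k (fun F => negSupport a ⊆ F ∧
        (F \ negSupport a ∈ degreeComplex J a ∧ F \ negSupport a ∉ degreeComplex I a)) q := by
  have hvan : ∀ (a : Fin n → ℤ) (j : ℤ),
      Subsingleton (ReducedRelCohomology k (degreeComplex J a) (degreeComplex I a) j) ↔
        FamilyVanishes k (fun F => negSupport a ⊆ F ∧ (F \ negSupport a ∈ degreeComplex J a ∧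
          F \ negSupport a ∉ degreeComplex I a)) (j + 1 + (negSupport a).card) := fun a j => by
    rw [subsingleton_reducedRelCohomology_iff, ← familyVanishes_union_iff k
      (G := negSupport a) fun F hF => hF.1.1]
  constructor
  · intro h a q hq
    by_cases hempty : ∅ ∈ degreeComplex J a
    · have h1 := h a ∅ hempty (q - (negSupport a).card - 1) (by
        rw [Finset.card_empty]
        push_cast
        omega)
      rw [link_degreeComplex J (Finset.disjoint_empty_left _),
        link_degreeComplex I (Finset.disjoint_empty_left _)] at h1
      have h2 : negOn a ∅ = a := by
        ext i
        simp [negOn]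
      rw [h2, hvan] at h1
      convert h1 using 1
      ring
    · -- the complex without faces
      intro c _ hc _
      refine ⟨0, fun F hF => absurd rfl hF, fun F hF => ?_⟩
      exact absurd ((degreeComplex J a).lower (Finset.empty_subset _) hF.2.1) hempty
  · intro h a F hF j hj
    rw [link_degreeComplex J hF.1, link_degreeComplex I hF.1, hvan]
    refine h _ _ ?_
    rw [negSupport_negOn, Finset.card_union_of_disjoint hF.1]
    push_cast
    omega

/-! ### Depth and dimension of `I/J` -/

theorem exists_supportDim_eq_natCast {R M : Type*} [CommRing R] [AddCommGroup M] [Module R M]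
    [FiniteRingKrullDim R] [Nontrivial M] :
    ∃ d : ℕ, Module.supportDim R M = d ∧ moduleDim R M = d := by
  have h1 : Module.supportDim R M ≠ ⊥ := Module.supportDim_ne_bot_of_nontrivial R M
  have h2 : Module.supportDim R M ≠ ⊤ :=
    ((Module.supportDim_le_ringKrullDim R M).trans_lt ringKrullDim_lt_top).ne
  obtain ⟨e, he⟩ := WithBot.ne_bot_iff_exists.1 h1
  have h3 : e ≠ ⊤ := by
    rintro rfl
    exact h2 he.symm
  obtain ⟨d, rfl⟩ := ENat.ne_top_iff_exists.1 h3
  refine ⟨d, he.symm, ?_⟩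
  rw [moduleDim, ← he]
  rfl

/-- For a sequence in `(x_1, …, x_n)` the condition `(r_1, …, r_t) M ≠ M` holds automatically on
`M = I/J ≠ 0`, by `le_of_smul_eq_zero`. -/
theorem isRegular_of_isWeaklyRegular {I J : Ideal (MvPolynomial (Fin n) k)}
    (hI : IsMonomialIdeal I) (hJ : IsMonomialIdeal J)
    [Nontrivial (↥I ⧸ Submodule.submoduleOf J I)] {rs : List (MvPolynomial (Fin n) k)}
    (hrs : ∀ r ∈ rs, r ∈ idealOfVars (Fin n) k)
    (h : RingTheory.Sequence.IsWeaklyRegular (↥I ⧸ Submodule.submoduleOf J I) rs) :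
    RingTheory.Sequence.IsRegular (↥I ⧸ Submodule.submoduleOf J I) rs := by
  refine ⟨h, fun htop => ?_⟩
  have hle : Ideal.ofList rs ≤ idealOfVars (Fin n) k := Ideal.span_le.2 hrs
  obtain ⟨r, hr, hr0⟩ := Submodule.exists_sub_one_mem_and_smul_eq_zero_of_fg_of_le_smul
    (idealOfVars (Fin n) k) (⊤ : Submodule (MvPolynomial (Fin n) k)
      (↥I ⧸ Submodule.submoduleOf J I)) Module.Finite.fg_top
      (htop.le.trans (Submodule.smul_mono_left hle))
  have hIJ := le_of_smul_eq_zero hI hJ hr fun f hf => by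
    have h1 := hr0 (Submodule.Quotient.mk ⟨f, hf⟩) trivial
    rw [← Submodule.Quotient.mk_smul, Submodule.Quotient.mk_eq_zero] at h1
    exact h1
  refine not_subsingleton (↥I ⧸ Submodule.submoduleOf J I) ?_
  rw [Submodule.Quotient.subsingleton_iff, Submodule.submoduleOf_eq_top]
  exact hIJ

/-- As depth never exceeds the dimension, `I/J` is Cohen–Macaulay as soon as there is a regular
sequence of length `dim (I/J)`. -/
theorem isCohenMacaulay_iff_exists {I J : Ideal (MvPolynomial (Fin n) k)}
    (hI : IsMonomialIdeal I) (hJ : IsMonomialIdeal J)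
    [Nontrivial (↥I ⧸ Submodule.submoduleOf J I)] {d : ℕ}
    (hd : Module.supportDim (MvPolynomial (Fin n) k) (↥I ⧸ Submodule.submoduleOf J I) = d) :
    IsCohenMacaulay k n (↥I ⧸ Submodule.submoduleOf J I) ↔
      ∃ rs : List (MvPolynomial (Fin n) k), rs.length = d ∧
        (∀ r ∈ rs, r ∈ idealOfVars (Fin n) k) ∧
        RingTheory.Sequence.IsWeaklyRegular (↥I ⧸ Submodule.submoduleOf J I) rs := by
  have hle : ∀ rs : {rs : List (MvPolynomial (Fin n) k) // (∀ r ∈ rs, r ∈ idealOfVars (Fin n) k) ∧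
      RingTheory.Sequence.IsRegular (↥I ⧸ Submodule.submoduleOf J I) rs},
      (rs.1.length : ℕ∞) ≤ d := by
    intro rs
    have h1 := length_le_supportDim_of_isRegular rs.1 rs.2.2
    rw [hd] at h1
    exact_mod_cast h1
  rw [IsCohenMacaulay, or_iff_right (not_subsingleton _), hd]
  change ((d : ℕ∞) : WithBot ℕ∞) = _ ↔ _
  rw [WithBot.coe_inj]
  constructor
  · intro h
    have : Nonempty {rs : List (MvPolynomial (Fin n) k) //
        (∀ r ∈ rs, r ∈ idealOfVars (Fin n) k) ∧
          RingTheory.Sequence.IsRegular (↥I ⧸ Submodule.submoduleOf J I) rs} :=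
      ⟨⟨[], by simp, .nil _ _⟩⟩
    obtain ⟨rs, hrs⟩ := ENat.exists_eq_iSup_of_lt_top (lt_of_eq_of_lt h.symm (ENat.natCast_lt_top d))
    refine ⟨rs.1, ?_, rs.2.1, rs.2.2.toIsWeaklyRegular⟩
    exact_mod_cast hrs.trans h.symm
  · rintro ⟨rs, hlen, hmem, hrs⟩
    refine le_antisymm ?_ (iSup_le hle)
    rw [← hlen]
    exact le_iSup_of_le ⟨rs, hmem, isRegular_of_isWeaklyRegular hI hJ hmem hrs⟩ le_rfl

/-- Depth at least `d` means that the local cohomology of `I/J`, read degree by degree, vanishes in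
the degrees below `d`. -/
theorem exists_isWeaklyRegular_iff {I J : Ideal (MvPolynomial (Fin n) k)}
    (hI : IsMonomialIdeal I) (hJ : IsMonomialIdeal J) (d : ℕ) :
    (∃ rs : List (MvPolynomial (Fin n) k), rs.length = d ∧
        (∀ r ∈ rs, r ∈ idealOfVars (Fin n) k) ∧
        RingTheory.Sequence.IsWeaklyRegular (↥I ⧸ Submodule.submoduleOf J I) rs) ↔
      ∀ a : Fin n → ℤ, ∀ q : ℤ, q < d → FamilyVanishes k (fun F => negSupport a ⊆ F ∧
        (F \ negSupport a ∈ degreeComplex J a ∧ F \ negSupport a ∉ degreeComplex I a)) q := by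
  constructor
  · rintro ⟨rs, hlen, hmem, hrs⟩ a q hq
    obtain ⟨l, hl⟩ := (eventually_isDegree_shift_iff I J a).exists
    have h1 : (fun F => negSupport a ⊆ F ∧ (F \ negSupport a ∈ degreeComplex J a ∧
        F \ negSupport a ∉ degreeComplex I a)) = fun F => IsDegree I J (shift a l F) :=
      funext fun F => propext (hl F).symm
    rw [h1]
    refine familyVanishes_isDegree hI hJ (fun c hdeg hc => ?_) a
    refine exists_koszulD_eq_of_isWeaklyRegular rs (fun r hr => ?_) hrs (by rwa [hlen]) hdeg hc
    have h2 : idealOfVars (Fin n) k ≤ (Ideal.span (Set.range fun v =>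
        (X v : MvPolynomial (Fin n) k) ^ l)).radical := by
      rw [idealOfVars, Ideal.span_le]
      rintro _ ⟨v, rfl⟩
      exact ⟨l, Ideal.subset_span ⟨v, rfl⟩⟩
    exact h2 (hmem r hr)
  · intro h
    exact exists_isWeaklyRegular_of_limitKoszulVanishes d fun q hq =>
      limitKoszulVanishes_of_familyVanishes hI hJ fun a => h a q hq

end Criterion

end RelReisner

theorem theorem5p2 {k : Type*} [Field k] {n : ℕ} (I J : Ideal (MvPolynomial (Fin n) k))
    (hI : IsMonomialIdeal I) (hJ : IsMonomialIdeal J) (hJI : J ≤ I) :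
    IsCohenMacaulay k n (↥I ⧸ Submodule.submoduleOf J I) ↔
      ∀ (a : Fin n → ℤ), ∀ F ∈ degreeComplex J a, ∀ j : ℤ,
        j < moduleDim (MvPolynomial (Fin n) k) (↥I ⧸ Submodule.submoduleOf J I)
            - ((negSupport a).card : ℤ) - (F.card : ℤ) - 1 →
          Subsingleton
            (ReducedRelCohomology k (link (degreeComplex J a) F) (link (degreeComplex I a) F) j) := by
  rw [forall_link_iff_forall_degreeComplex]
  rcases subsingleton_or_nontrivial (↥I ⧸ Submodule.submoduleOf J I) with hM | hM
  · refine iff_of_true (Or.inl hM) fun a q hq => ?_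
    have h1 : moduleDim (MvPolynomial (Fin n) k) (↥I ⧸ Submodule.submoduleOf J I) = -1 := by
      rw [moduleDim, Module.supportDim_eq_bot_of_subsingleton]
      rfl
    intro c hdeg _ _
    rw [hdeg.eq_zero_of_neg (by omega)]
    exact ⟨0, fun F hF => absurd rfl hF, fun F _ => by rw [map_zero]⟩
  · have : FiniteRingKrullDim (MvPolynomial (Fin n) k) := by
      rw [finiteRingKrullDim_iff_ne_bot_and_top, MvPolynomial.ringKrullDim_of_isNoetherianRing,
        ringKrullDim_eq_zero_of_field, zero_add]
      exact ⟨WithBot.natCast_ne_bot _, fun h => ENat.natCast_ne_top _ (WithBot.coe_inj.1 h)⟩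
    obtain ⟨d, hd, hd'⟩ := exists_supportDim_eq_natCast (R := MvPolynomial (Fin n) k)
      (M := ↥I ⧸ Submodule.submoduleOf J I)
    rw [isCohenMacaulay_iff_exists hI hJ hd, exists_isWeaklyRegular_iff hI hJ, hd']
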